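/- Setting. Let $\mathcal H$ be a complex Hilbert space and $D\subset\mathcal H$ a linear subspace. Let $(-1)^F$ be a bounded self-adjoint involution of $\mathcal H$ mapping $D$ to $D$; an operator $D\to D$ is called bosonic (fermionic) if it commutes (anticommutes) with $(-1)^F$. Fix $\rho>0$. Let $P_a$ ($a=1,2,3$) and $R$ be linear operators $D\to D$. For each $\gamma$ in an interval $s\subset\mathbb R$, let $Q_\alpha(\gamma),\bar Q^\alpha(\gamma)$ ($\alpha=1,2$) and $H(\gamma)$ be linear operators $D\to D$. Here $P_a,R,H$ are bosonic and symmetric, $Q_\alpha,\bar Q^\alpha$ are fermionic, and $\bar Q^\alpha=(Q_\alpha)^\dagger$ on $D$, i.e. $\langle Q_\alpha\phi,\psi\rangle=\langle\phi,\bar Q^\alpha\psi\rangle$ for $\phi,\psi\in D$. Suppose that $P_a$ and $R$ do not depend on $\gamma$ and that for every $\gamma\in s$ the (centrally extended) $su(2|1)$ weak supersymmetry algebra holds on $D$ (with $\sigma_a$ the Pauli matrices): $$[P_a,P_b]=-\tfrac{2i}{\rho}\varepsilon_{abc}P_c,\quad [Q_\alpha,P_a]=-\tfrac1\rho(\sigma_a)_\alpha{}^\beta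 Q_\beta,\quad [\bar Q^\alpha,P_a]=\tfrac1\rho\bar Q^\beta(\sigma_a)_\beta{}^\alpha,$$ $$\{Q_\alpha,\bar Q^\beta\}=2\left(H-\tfrac R\rho\right)\delta_\alpha{}^\beta+2(\sigma_a)_\alpha{}^\beta P_a,\quad [Q_\alpha,R]=-Q_\alpha,\quad [\bar Q^\alpha,R]=\bar Q^\alpha,$$ $$[H,P_a]=[H,R]=[R,P_a]=0,\quad \{Q_\alpha,Q_\beta\}=\{\bar Q^\alpha,\bar Q^\beta\}=[Q_\alpha,H]=[\bar Q^\alpha,H]=0.$$ Suppose that the deformation is continuous in the sense that $\gamma\mapsto\langle\phi,H(\gamma)\psi\rangle$ is continuous on $s$ for all $\phi,\psi\in D$. Theorem. (1) Let $\beta>0$. Suppose that for every $\gamma\in s$ the eigenvectors of $H(\gamma)$ in $D$ span a dense subspace of $\mathcal H$, that $e^{-\beta H(\gamma)}$ is trace class, and that the partition function $\gamma\mapsto\mathrm{Tr}\,e^{-\beta H(\gamma)}$ is continuous on $s$. Then the index $I(\gamma)=\mathrm{Tr}\{(-1)^Fe^{-\beta H(\gamma)}\}$ satisfies $\frac{d}{d\gamma}I=0$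 on $s$, and $I$ does not depend on $\gamma\in s$. (2) Let $\beta>0$, let $M_1,\dots,M_n$ be bosonic symmetric operators $D\to D$ that do not depend on $\gamma$, and let $\mu_1,\dots,\mu_n\in\mathbb R$. Suppose that all $M_j$ commute with $H(\gamma)$ and with one pair $Q_\alpha(\gamma),\bar Q^\alpha(\gamma)$ ($\alpha\in\{1,2\}$ fixed) for every $\gamma\in s$. Suppose that for every $\gamma\in s$ the simultaneous eigenvectors in $D$ of $H(\gamma)$ and $\sum_j\mu_jM_j$ span a dense subspace, that $e^{-\beta H(\gamma)}e^{\sum_j\mu_jM_j}$ extends to a trace class operator, and that its trace is continuous in $\gamma\in s$. Then the generalized index $\tilde I(\gamma)=\mathrm{Tr}\{(-1)^Fe^{-\beta H(\gamma)}e^{\sum_j\mu_jM_j}\}$ satisfies $\frac{d}{d\gamma}\tilde I=0$ on $s$, and $\tilde I$ does not depend on $\gamma\in s$. -/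

import Mathlib

open scoped InnerProductSpace

/-!# Weak supersymmetry: operators on a common invariant domain -/

namespace WeakSUSY

noncomputable section

/-- The Pauli matrices `σ₁, σ₂, σ₃` (indexed by `0, 1, 2`); `pauli a α β` is `(σ_a)_α^β`. -/
def pauli : Fin 3 → Matrix (Fin 2) (Fin 2) ℂ :=
  ![!![0, 1; 1, 0], !![0, -Complex.I; Complex.I, 0], !![1, 0; 0, -1]]

/-- The Levi-Civita symbol `ε_{abc}`: the determinant of the matrix whose rows are
the basis vectors `e_a, e_b, e_c`. -/
def leviCivita (a b c : Fin 3) : ℂ :=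
  Matrix.det (Matrix.of ![Pi.single a (1 : ℂ), Pi.single b 1, Pi.single c 1])

variable {E : Type*} [NormedAddCommGroup E] [InnerProductSpace ℂ E] {D : Submodule ℂ E}

/-- `Γ = (-1)^F`: a bounded self-adjoint involution of the Hilbert space that preserves the
common domain `D`. Its `+1` and `-1` eigenvectors are the bosonic and fermionic states. -/
structure IsFermionParity (D : Submodule ℂ E) (Γ : E →L[ℂ] E) : Prop where
  symm : ∀ x y : E, ⟪Γ x, y⟫_ℂ = ⟪x, Γ y⟫_ℂ
  sq : ∀ x : E, Γ (Γ x) = x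
  mem : ∀ x ∈ D, Γ x ∈ D

/-- `A` is even (bosonic): it commutes with `Γ`. -/
def IsEven (Γ : E →L[ℂ] E) (A : Module.End ℂ D) : Prop :=
  ∀ ψ φ : D, (φ : E) = Γ ψ → (A φ : E) = Γ (A ψ)

/-- `A` is odd (fermionic): it anticommutes with `Γ`. -/
def IsOdd (Γ : E →L[ℂ] E) (A : Module.End ℂ D) : Prop :=
  ∀ ψ φ : D, (φ : E) = Γ ψ → (A φ : E) = -Γ (A ψ)

/-- `A` is symmetric (Hermitian) on `D`. -/
def IsHermitianOn (A : Module.End ℂ D) : Prop :=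
  ∀ φ ψ : D, ⟪(A φ : E), (ψ : E)⟫_ℂ = ⟪(φ : E), (A ψ : E)⟫_ℂ

/-- The (centrally extended) `su(2|1)` weak supersymmetry algebra with radius `ρ`, realized by
linear operators on the common invariant domain `D`. -/
structure WeakSUSYAlgebra (Γ : E →L[ℂ] E) (ρ : ℝ) (P : Fin 3 → Module.End ℂ D)
    (R : Module.End ℂ D) (Q Qbar : Fin 2 → Module.End ℂ D) (H : Module.End ℂ D) : Prop where
  even_P : ∀ a, IsEven Γ (P a)
  even_R : IsEven Γ R
  even_H : IsEven Γ H
  odd_Q : ∀ α, IsOdd Γ (Q α)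
  odd_Qbar : ∀ α, IsOdd Γ (Qbar α)
  herm_P : ∀ a, IsHermitianOn (P a)
  herm_R : IsHermitianOn R
  herm_H : IsHermitianOn H
  /-- `Q̄^α = (Q_α)†` -/
  adj_Q : ∀ α (φ ψ : D), ⟪(Q α φ : E), (ψ : E)⟫_ℂ = ⟪(φ : E), (Qbar α ψ : E)⟫_ℂ
  comm_P_P : ∀ a b, P a * P b - P b * P a
    = (-2 * Complex.I / (ρ : ℂ)) • ∑ c, leviCivita a b c • P c
  comm_Q_P : ∀ α a, Q α * P a - P a * Q α = -(1 / (ρ : ℂ)) • ∑ β, pauli a α β • Q β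
  comm_Qbar_P : ∀ α a, Qbar α * P a - P a * Qbar α = (1 / (ρ : ℂ)) • ∑ β, pauli a β α • Qbar β
  anticomm_Q_Qbar : ∀ α β, Q α * Qbar β + Qbar β * Q α
    = (if α = β then (2 : ℂ) • (H - (1 / (ρ : ℂ)) • R) else 0)
      + (2 : ℂ) • ∑ a, pauli a α β • P a
  comm_Q_R : ∀ α, Q α * R - R * Q α = -Q α
  comm_Qbar_R : ∀ α, Qbar α * R - R * Qbar α = Qbar α
  comm_H_P : ∀ a, H * P a = P a * H
  comm_H_R : H * R = R * H
  comm_R_P : ∀ a, R * P a = P a * R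
  anticomm_Q_Q : ∀ α β, Q α * Q β + Q β * Q α = 0
  anticomm_Qbar_Qbar : ∀ α β, Qbar α * Qbar β + Qbar β * Qbar α = 0
  comm_Q_H : ∀ α, Q α * H = H * Q α
  comm_Qbar_H : ∀ α, Qbar α * H = H * Qbar α

/-- The simultaneous eigenvectors, lying in `D`, of all the operators in `S` span a dense
subspace of the Hilbert space. -/
def HasCompleteEigenstates (S : Set (Module.End ℂ D)) : Prop :=
  Dense (Submodule.span ℂ {x : E | ∃ v : D, (v : E) = x ∧ ∀ A ∈ S, ∃ a : ℝ, A v = (a : ℂ) • v} :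
    Set E)

/-- The graph of `e^A`, for a symmetric `A` with a complete system of eigenvectors in `D`:
`y = e^A x` iff `⟨v, y⟩ = e^a ⟨v, x⟩` for every eigenvector `v` of `A`, `A v = a v`. This is the
(in general unbounded) self-adjoint operator `e^A` on its maximal domain. -/
def expRel (A : Module.End ℂ D) (x y : E) : Prop :=
  ∀ (v : D) (a : ℝ), A v = (a : ℂ) • v → ⟪(v : E), y⟫_ℂ = (Real.exp a : ℂ) * ⟪(v : E), x⟫_ℂ

/-- The operator with graph `r` is the restriction of a bounded everywhere defined operator. -/
def IsBoundedRel (r : E → E → Prop) : Prop :=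
  ∃ T : E →L[ℂ] E, ∀ x y, r x y → T x = y

open scoped Classical in
/-- The bounded everywhere defined extension of the operator with graph `r`, `0` if there is none;
it is unique if `r` is densely defined. -/
def toBounded (r : E → E → Prop) : E →L[ℂ] E :=
  if h : IsBoundedRel r then h.choose else 0

/-- The graph of `e^{-βH}`. -/
def boltzmann (β : ℝ) (H : Module.End ℂ D) : E → E → Prop :=
  expRel (-(β : ℂ) • H)

/-- The graph of `e^{-βH} e^{∑ μ_j M_j}`: the composition of the (possibly unbounded) operators
`e^{∑ μ_j M_j}`, applied first, and `e^{-βH}`. -/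
def genBoltzmann (β : ℝ) (H : Module.End ℂ D) {n : ℕ} (μ : Fin n → ℝ)
    (M : Fin n → Module.End ℂ D) : E → E → Prop :=
  Relation.Comp (expRel (∑ j, (μ j : ℂ) • M j)) (boltzmann β H)

variable [CompleteSpace E]

/-- The trace `∑_i ⟨e_i, T e_i⟩` over a Hilbert basis; for trace class `T` it does not depend on
the basis. -/
def trace (T : E →L[ℂ] E) : ℂ :=
  ∑' i, ⟪(exists_hilbertBasis ℂ E).choose_spec.choose i,
    T ((exists_hilbertBasis ℂ E).choose_spec.choose i)⟫_ℂ

/-- `T` is trace class: `∑_i ⟨e_i, |T| e_i⟩` converges for every Hilbert basis, `|T| = √(T†T)`. -/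
def IsTraceClass (T : E →L[ℂ] E) : Prop :=
  ∀ (w : Set E) (b : HilbertBasis w ℂ E), Summable fun i => (⟪b i, CFC.abs T (b i)⟫_ℂ).re

/-- The operator with graph `r` extends to a bounded trace class operator. -/
def IsTraceClassRel (r : E → E → Prop) : Prop :=
  IsBoundedRel r ∧ IsTraceClass (toBounded r)

/-- `Tr T`, for the operator `T` with graph `r`. -/
def traceRel (r : E → E → Prop) : ℂ := trace (toBounded r)

/-- The supertrace `⟨⟨T⟩⟩ = Tr {(-1)^F T}`, for the operator `T` with graph `r`. -/
def supertrace (Γ : E →L[ℂ] E) (r : E → E → Prop) : ℂ := trace (Γ ∘L toBounded r)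

end

end WeakSUSY

/-!
# The index of weak supersymmetry is invariant under continuous deformations

Put `A γ = β H(γ) - K`, where `K` is `0` for the partition function and `∑ μ_j M_j` for its
generalization, and `𝒬 = Q_α + Q̄^α`. The algebra gives `𝒬² = (2/β) (A γ - B)` with the symmetric
operator `B = β (R/ρ - ∑ (σ_a)_α^α P_a) - K`, which does not depend on `γ` (`bpsHamiltonian`,
`WeakSUSYAlgebra.isSupercharge`). The operators `A γ`, `B` and `G = (-1)^F` commute. Since
`e^{-A γ}` is trace class, the eigenspaces of `A γ` are finite-dimensional, so there is a Hilbert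
basis of joint eigenvectors in `D` (`IsGibbsOperator.exists_hilbertBasis`), and all traces are sums
over the joint eigenvalues `(λ, ε, h)` of `B`, `G`, `A γ`.

Integrality: `𝒬` commutes with `A γ` and `B`, reverses `ε`, and is injective where `h ≠ λ`. So in the
supertrace restricted to `B = λ` only the states with `h = λ` survive, and it equals
`e^{-λ}` times an integer (`IsGibbsOperator.sectorSum_sub`).

Continuity: let `Z_S(γ)` be the part of the partition function from the sectors `(λ, ε) ∈ S`.
Peierls' inequality `Z_S(γ) ≥ ∑ exp (-⟨e_k, A γ e_k⟩)` for orthonormal `e_k ∈ D` in these sectors,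
applied to eigenvectors of `A γ₀`, shows that `Z_S` is lower semicontinuous at `γ₀`, because the
matrix elements of `H` on `D` are continuous (`lowerSemicontinuousOn_sectorSum`). The sum of `Z_S`
and the contribution of the complement of `S` is the full partition function, which is continuous
by assumption; hence `Z_S` is continuous (`continuousOn_sectorSum`).

The integer belonging to each `λ` is thus continuous on an interval, hence constant, and the index
is the sum over `λ` of these integers weighted by `e^{-λ}` (`trace_parity_comp_eq`).
-/

namespace WeakSUSY

noncomputable section

open Module.End Filter Topology

/-! ### Traces of diagonal operators -/

section Trace

variable {E : Type*} [NormedAddCommGroup E] [InnerProductSpace ℂ E] {ι κ : Type*}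

/-- Parseval's identity. -/
theorem hasSum_norm_inner_sq (b : HilbertBasis ι ℂ E) (x : E) :
    HasSum (fun i => ‖⟪b i, x⟫_ℂ‖ ^ 2) (‖x‖ ^ 2) := by
  have h := Complex.hasSum_re (b.hasSum_inner_mul_inner x x)
  convert h using 1
  · ext i
    rw [← inner_conj_symm x (b i), ← Complex.normSq_eq_conj_mul_self, Complex.ofReal_re,
      Complex.normSq_eq_norm_sq]
  · rw [inner_self_eq_norm_sq_to_K]
    norm_cast

theorem hasSum_norm_inner_sq' (b : HilbertBasis ι ℂ E) (x : E) :
    HasSum (fun i => ‖⟪x, b i⟫_ℂ‖ ^ 2) (‖x‖ ^ 2) := by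
  simpa only [norm_inner_symm] using hasSum_norm_inner_sq b x

/-- The diagonal matrix elements of an operator that is diagonal in the Hilbert basis `f`. -/
theorem hasSum_diagonal_inner (f : HilbertBasis κ ℂ E) (A : E →L[ℂ] E) (a : κ → ℂ)
    (hA : ∀ k, A (f k) = a k • f k) (x : E) :
    HasSum (fun k => a k * (‖⟪f k, x⟫_ℂ‖ ^ 2 : ℝ)) ⟪x, A x⟫_ℂ := by
  have h := ((f.hasSum_repr x).mapL A).mapL (innerSL ℂ x)
  refine h.congr_fun fun k => ?_
  rw [innerSL_apply_apply, map_smul, hA, inner_smul_right, inner_smul_right, f.repr_apply_apply,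
    ← inner_conj_symm x (f k), mul_left_comm, Complex.mul_conj, Complex.normSq_eq_norm_sq]

theorem tsum_inner_eq_of_diagonal (f : HilbertBasis κ ℂ E) (A : E →L[ℂ] E) (a : κ → ℂ)
    (hA : ∀ k, A (f k) = a k • f k) (ha : Summable a) (b : HilbertBasis ι ℂ E) :
    ∑' i, ⟪b i, A (b i)⟫_ℂ = ∑' k, a k := by
  have hsum (k : κ) : HasSum (fun i => ‖⟪f k, b i⟫_ℂ‖ ^ 2) 1 := by
    simpa [f.orthonormal.1 k] using hasSum_norm_inner_sq' b (f k)
  let g : κ → ι → ℂ := fun k i => a k * (‖⟪f k, b i⟫_ℂ‖ ^ 2 : ℝ)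
  have hg (k : κ) (i : ι) : ‖g k i‖ = ‖a k‖ * ‖⟪f k, b i⟫_ℂ‖ ^ 2 := by
    rw [norm_mul, Complex.norm_real, Real.norm_of_nonneg (sq_nonneg _)]
  have hs : Summable (Function.uncurry g) := by
    refine Summable.of_norm ((summable_prod_of_nonneg fun p => norm_nonneg _).2
      ⟨fun k => ?_, ?_⟩)
    · simpa only [Function.uncurry_apply_pair, hg] using (hsum k).summable.mul_left ‖a k‖
    · simpa only [Function.uncurry_apply_pair, hg, tsum_mul_left, (hsum _).tsum_eq, mul_one]
        using ha.norm
  calc ∑' i, ⟪b i, A (b i)⟫_ℂ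
      = ∑' i, ∑' k, g k i :=
        tsum_congr fun i => (hasSum_diagonal_inner f A a hA (b i)).tsum_eq.symm
    _ = ∑' k, ∑' i, g k i := hs.tsum_comm
    _ = ∑' k, a k := tsum_congr fun k => by
        have := (Complex.hasSum_ofReal.2 (hsum k)).mul_left (a k)
        exact this.tsum_eq.trans (by simp)

/-- The trace of an operator that is diagonal in some Hilbert basis, with summable eigenvalues, is
the sum of its eigenvalues. -/
theorem trace_eq_tsum_of_diagonal [CompleteSpace E] (f : HilbertBasis κ ℂ E) (A : E →L[ℂ] E)
    (a : κ → ℂ) (hA : ∀ k, A (f k) = a k • f k) (ha : Summable a) :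
    trace A = ∑' k, a k :=
  tsum_inner_eq_of_diagonal f A a hA ha _

theorem summable_inner_of_orthonormal [CompleteSpace E] {T : E →L[ℂ] E} (hT : 0 ≤ T)
    (htr : IsTraceClass T) {v : κ → E} (hv : Orthonormal ℂ v) :
    Summable fun k => (⟪v k, T (v k)⟫_ℂ).re := by
  obtain ⟨w, b, hw, hb⟩ := hv.toSubtypeRange.exists_hilbertBasis_extension
  have h := htr w b
  rw [CFC.abs_of_nonneg T hT] at h
  have hinj : Function.Injective fun k => (⟨v k, hw ⟨k, rfl⟩⟩ : w) := fun k l hkl =>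
    hv.linearIndependent.injective (congrArg Subtype.val hkl)
  simpa [Function.comp_def, hb] using h.comp_injective hinj

end Trace

/-! ### The Gibbs operator of a symmetric operator -/

section Gibbs

variable {E : Type*} [NormedAddCommGroup E] [InnerProductSpace ℂ E]
  {D : Submodule ℂ E}

theorem inner_eq_zero_of_eigenvalue_ne {A : Module.End ℂ D} (hA : A.IsSymmetric) {v w : D}
    {a b : ℂ} (hv : A v = a • v) (hw : A w = b • w) (hab : a ≠ b) : ⟪(v : E), (w : E)⟫_ℂ = 0 :=
  hA.orthogonalFamily_eigenspaces hab ⟨v, mem_eigenspace_iff.2 hv⟩ ⟨w, mem_eigenspace_iff.2 hw⟩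

variable [CompleteSpace E]

/-- The bounded operator `T` is a trace class realization of `e^{-A}`, where `A` is a symmetric
operator on `D`: the eigenvectors of `A` in `D` on which `T` acts as `e^{-A}` span a dense
subspace. -/
structure IsGibbsOperator (A : Module.End ℂ D) (T : E →L[ℂ] E) : Prop where
  symm : A.IsSymmetric
  dense : Dense (Submodule.span ℂ {x : E | ∃ (v : D) (a : ℝ), (v : E) = x ∧ A v = (a : ℂ) • v ∧
    T x = (Real.exp (-a) : ℂ) • x} : Set E)
  traceClass : IsTraceClass T

namespace IsGibbsOperator

variable {A : Module.End ℂ D} {T : E →L[ℂ] E}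

/-- `⟨x, T x⟩ = ‖e^{-A/2} x‖² ≥ 0` for `x` in the span of the eigenvectors. -/
theorem nonneg (h : IsGibbsOperator A T) : 0 ≤ T := by
  rw [ContinuousLinearMap.nonneg_iff_isPositive, ContinuousLinearMap.isPositive_iff_complex]
  have key : ∀ x : E, 0 ≤ (⟪T x, x⟫_ℂ).re ∧ (⟪T x, x⟫_ℂ).im = 0 := by
    have hcl : IsClosed {x : E | 0 ≤ (⟪T x, x⟫_ℂ).re ∧ (⟪T x, x⟫_ℂ).im = 0} :=
      (isClosed_le continuous_const
        (Complex.continuous_re.comp (T.continuous.inner continuous_id))).and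
        (isClosed_eq (Complex.continuous_im.comp (T.continuous.inner continuous_id))
          continuous_const)
    refine fun x => hcl.closure_subset_iff.2 (fun x hx => ?_) (h.dense x)
    obtain ⟨n, c, g, rfl⟩ := Submodule.mem_span_set'.1 hx
    choose v a hv hA hT using fun i => (g i).2
    have hij (i j : Fin n) : ⟪T (g i : E), (g j : E)⟫_ℂ =
        ⟪(Real.exp (-a i / 2) : ℂ) • (g i : E), (Real.exp (-a j / 2) : ℂ) • (g j : E)⟫_ℂ := by
      rw [hT, inner_smul_left, inner_smul_left, inner_smul_right, Complex.conj_ofReal,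
        Complex.conj_ofReal, ← mul_assoc, ← Complex.ofReal_mul, ← Real.exp_add]
      by_cases hij : a i = a j
      · rw [hij]; ring_nf
      · have := inner_eq_zero_of_eigenvalue_ne h.symm (hA i) (hA j)
          (fun hh => hij (Complex.ofReal_injective hh))
        rw [← hv i, ← hv j, this, mul_zero, mul_zero]
    have : ⟪T (∑ i, c i • (g i : E)), ∑ i, c i • (g i : E)⟫_ℂ =
        ((‖∑ i, c i • (Real.exp (-a i / 2) : ℂ) • (g i : E)‖ ^ 2 : ℝ) : ℂ) := by
      have hn := inner_self_eq_norm_sq_to_K (𝕜 := ℂ)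
        (∑ i, c i • (Real.exp (-a i / 2) : ℂ) • (g i : E))
      rw [Complex.ofReal_pow]
      refine Eq.trans ?_ hn
      simp only [map_sum, map_smul, sum_inner, inner_sum]
      refine Finset.sum_congr rfl fun i _ => Finset.sum_congr rfl fun j _ => ?_
      rw [inner_smul_left, inner_smul_right, hij]
      conv_rhs => rw [inner_smul_left, inner_smul_right]
    simp only [Set.mem_ofPred_eq, this, Complex.ofReal_re, Complex.ofReal_im]
    exact ⟨sq_nonneg _, trivial⟩
  exact fun x => ⟨Complex.ext rfl (key x).2.symm, (key x).1⟩

theorem isSymmetric (h : IsGibbsOperator A T) (x y : E) : ⟪T x, y⟫_ℂ = ⟪x, T y⟫_ℂ :=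
  ((ContinuousLinearMap.nonneg_iff_isPositive T).1 h.nonneg).isSymmetric x y

/-- `T` acts as `e^{-A}` on all eigenvectors of `A`. -/
theorem apply_eigenvector (h : IsGibbsOperator A T) {v : D} {a : ℝ} (hv : A v = (a : ℂ) • v) :
    T v = (Real.exp (-a) : ℂ) • (v : E) := by
  refine h.dense.eq_of_inner_right (𝕜 := ℂ) fun x => ?_
  intro hx
  induction hx using Submodule.span_induction with
  | zero => simp
  | add x y _ _ hx hy => simp only [inner_add_left, hx, hy]
  | smul c x _ hx => simp only [inner_smul_left, hx]
  | mem x hx =>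
    obtain ⟨w, b, rfl, hw, hT⟩ := hx
    rw [← h.isSymmetric, hT, inner_smul_left, inner_smul_right, Complex.conj_ofReal]
    by_cases hab : b = a
    · rw [hab]
    · rw [inner_eq_zero_of_eigenvalue_ne h.symm hw hv
        (fun hh => hab (Complex.ofReal_injective hh)), mul_zero, mul_zero]

/-- The eigenspaces of `A` are finite-dimensional: an infinite orthonormal family in one of them
would contribute infinitely many equal terms to the trace of `e^{-A}`. -/
theorem finiteDimensional_eigenspace (h : IsGibbsOperator A T) (a : ℝ) :
    FiniteDimensional ℂ (eigenspace A (a : ℂ)) := by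
  by_contra hinf
  let b := Module.Basis.ofVectorSpace ℂ (eigenspace A (a : ℂ))
  have : Infinite (Module.Basis.ofVectorSpaceIndex ℂ (eigenspace A (a : ℂ))) := by
    by_contra hfin
    rw [not_infinite_iff_finite] at hfin
    exact hinf (Module.Finite.of_basis b)
  let u : ℕ → eigenspace A (a : ℂ) := b ∘ Infinite.natEmbedding _
  have hu : LinearIndependent ℂ u := b.linearIndependent.comp _ (Function.Embedding.injective _)
  let e := InnerProductSpace.gramSchmidtNormed ℂ u
  have he : Orthonormal ℂ e := InnerProductSpace.gramSchmidtNormed_orthonormal hu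
  have he' : Orthonormal ℂ fun k => (((e k : eigenspace A (a : ℂ)) : D) : E) := he
  have hs := summable_inner_of_orthonormal h.nonneg h.traceClass he'
  have hc (k : ℕ) : (⟪((e k : D) : E), T ((e k : D) : E)⟫_ℂ).re = Real.exp (-a) := by
    rw [h.apply_eigenvector (mem_eigenspace_iff.1 (e k).2), inner_smul_right,
      inner_self_eq_norm_sq_to_K, he'.1 k, RCLike.ofReal_one, one_pow,
      mul_one, Complex.ofReal_re]
  simp only [hc] at hs
  exact (Real.exp_pos _).ne' ((summable_const_iff _).1 hs)

end IsGibbsOperator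

end Gibbs

/-! ### Joint eigenspaces -/

section Joint

variable {E : Type*} [NormedAddCommGroup E] [InnerProductSpace ℂ E] {D : Submodule ℂ E}

/-- The subspace of `D` on which `A = h`, `B = λ` and `G = ε`, labelled by `((λ, ε), h)`. The label
`(λ, ε)` of the operators `B`, `G` is called the sector. -/
def jointEigenspace (A B G : Module.End ℂ D) (i : (ℂ × ℤˣ) × ℝ) : Submodule ℂ D :=
  eigenspace A (i.2 : ℂ) ⊓ (eigenspace B i.1.1 ⊓ eigenspace G ((i.1.2 : ℤ) : ℂ))

/-- The multiplicity of the joint eigenvalue `((λ, ε), h)`. -/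
def multiplicity (A B G : Module.End ℂ D) (i : (ℂ × ℤˣ) × ℝ) : ℕ :=
  Module.finrank ℂ (jointEigenspace A B G i)

/-- The contribution `∑ e^{-h}` to the partition function of `A` of the states in the sectors
`(λ, ε) ∈ S`. -/
def sectorSum (A B G : Module.End ℂ D) (S : Set (ℂ × ℤˣ)) : ℝ :=
  ∑' i, S.indicator (fun _ => (1 : ℝ)) i.1 * (Real.exp (-i.2) * multiplicity A B G i)

variable {A B G : Module.End ℂ D}

theorem mem_jointEigenspace {i : (ℂ × ℤˣ) × ℝ} {v : D} :
    v ∈ jointEigenspace A B G i ↔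
      A v = (i.2 : ℂ) • v ∧ B v = i.1.1 • v ∧ G v = ((i.1.2 : ℤ) : ℂ) • v := by
  simp only [jointEigenspace, Submodule.mem_inf, mem_eigenspace_iff]

/-- The operators `B` and `G` that label the sectors: commuting symmetric operators, the second
being an involution. -/
structure IsSectorPair (B G : Module.End ℂ D) : Prop where
  symm_left : B.IsSymmetric
  symm_right : G.IsSymmetric
  sq : G * G = 1
  comm : Commute B G

namespace IsSectorPair

theorem inner_eq_zero (h : IsSectorPair B G) {j l : ℂ × ℤˣ} (hjl : j ≠ l) {v w : D}
    (hv : B v = j.1 • v ∧ G v = ((j.2 : ℤ) : ℂ) • v)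
    (hw : B w = l.1 • w ∧ G w = ((l.2 : ℤ) : ℂ) • w) : ⟪(v : E), (w : E)⟫_ℂ = 0 := by
  by_cases h1 : j.1 = l.1
  · refine inner_eq_zero_of_eigenvalue_ne h.symm_right hv.2 hw.2 fun h2 => hjl ?_
    exact Prod.ext h1 (Units.ext (by exact_mod_cast h2))
  · exact inner_eq_zero_of_eigenvalue_ne h.symm_left hv.1 hw.1 h1

theorem orthogonalFamily (h : IsSectorPair B G) (hA : A.IsSymmetric) :
    OrthogonalFamily ℂ (fun i => jointEigenspace A B G i)
      fun i => D.subtypeₗᵢ.comp (jointEigenspace A B G i).subtypeₗᵢ := by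
  rintro i j hij ⟨v, hv⟩ ⟨w, hw⟩
  rw [mem_jointEigenspace] at hv hw
  change ⟪(v : E), (w : E)⟫_ℂ = 0
  by_cases h1 : i.1 = j.1
  · refine inner_eq_zero_of_eigenvalue_ne hA hv.1 hw.1 fun h2 => hij ?_
    exact Prod.ext h1 (Complex.ofReal_injective h2)
  · exact h.inner_eq_zero h1 hv.2 hw.2

/-- A finite-dimensional eigenspace of an operator commuting with `B` and `G` decomposes into joint
eigenspaces. -/
theorem eigenspace_le_iSup (h : IsSectorPair B G) (hAB : Commute A B) (hAG : Commute A G) (a : ℝ)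
    [FiniteDimensional ℂ (eigenspace A (a : ℂ))] :
    eigenspace A (a : ℂ) ≤ ⨆ i, jointEigenspace A B G i := by
  have hB : Set.MapsTo B (eigenspace A (a : ℂ)) (eigenspace A (a : ℂ)) :=
    mapsTo_genEigenspace_of_comm hAB _ 1
  have hG : Set.MapsTo G (eigenspace A (a : ℂ)) (eigenspace A (a : ℂ)) :=
    mapsTo_genEigenspace_of_comm hAG _ 1
  have hcomm : Commute (B.restrict hB) (G.restrict hG) := by
    ext v
    exact congrArg Subtype.val (LinearMap.congr_fun h.comm v)
  have htop := LinearMap.IsSymmetric.iSup_iSup_eigenspace_inf_eigenspace_eq_top_of_commute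
    (h.symm_left.restrict_invariant hB) (h.symm_right.restrict_invariant hG) hcomm
  rw [← (eigenspace A (a : ℂ)).map_subtype_top, ← htop]
  simp only [Submodule.map_iSup]
  refine iSup_le fun α => iSup_le fun γ => ?_
  rintro _ ⟨w, ⟨hw1, hw2⟩, rfl⟩
  have hw1 : B w = α • (w : D) := congrArg Subtype.val (mem_eigenspace_iff.1 hw1)
  have hw2 : G w = γ • (w : D) := congrArg Subtype.val (mem_eigenspace_iff.1 hw2)
  by_cases hw0 : (w : D) = 0
  · change (w : D) ∈ _
    rw [hw0]; exact zero_mem _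
  have hγ : γ * γ = 1 := by
    have h2 : G (G w) = (w : D) := LinearMap.congr_fun h.sq (w : D)
    rw [hw2, map_smul, hw2, smul_smul] at h2
    refine smul_left_injective ℂ hw0 ?_
    simpa using h2
  obtain ⟨ε, hε⟩ : ∃ ε : ℤˣ, ((ε : ℤ) : ℂ) = γ := by
    rcases mul_self_eq_one_iff.1 hγ with rfl | rfl
    · exact ⟨1, by simp⟩
    · exact ⟨-1, by simp⟩
  refine Submodule.mem_iSup_of_mem ((α, ε), a) (mem_jointEigenspace.2 ⟨?_, hw1, ?_⟩)
  · exact mem_eigenspace_iff.1 w.2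
  · rw [hε]; exact hw2

end IsSectorPair

namespace IsGibbsOperator

variable [CompleteSpace E] {T : E →L[ℂ] E}

theorem finiteDimensional_jointEigenspace (h : IsGibbsOperator A T) (i : (ℂ × ℤˣ) × ℝ) :
    FiniteDimensional ℂ (jointEigenspace A B G i) :=
  have := h.finiteDimensional_eigenspace i.2
  Submodule.finiteDimensional_of_le (inf_le_left : _ ≤ eigenspace A (i.2 : ℂ))

/-- The Hilbert space has a basis of joint eigenvectors, lying in `D`. -/
theorem exists_hilbertBasis (h : IsGibbsOperator A T) (hBG : IsSectorPair B G)
    (hAB : Commute A B) (hAG : Commute A G) :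
    ∃ (f : HilbertBasis (Σ i, Fin (multiplicity A B G i)) ℂ E)
      (v : (Σ i, Fin (multiplicity A B G i)) → D),
      ∀ k, v k ∈ jointEigenspace A B G k.1 ∧ f k = v k := by
  have hfin (i) := h.finiteDimensional_jointEigenspace (B := B) (G := G) i
  let u : (Σ i, Fin (multiplicity A B G i)) → D := fun k =>
    (stdOrthonormalBasis ℂ (jointEigenspace A B G k.1) k.2 : jointEigenspace A B G k.1)
  have ho : Orthonormal ℂ fun k => (u k : E) :=
    (hBG.orthogonalFamily h.symm).orthonormal_sigma_orthonormal
      (fun i => (stdOrthonormalBasis ℂ (jointEigenspace A B G i)).orthonormal)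
  have hsp : ⊤ ≤ (Submodule.span ℂ (Set.range fun k => (u k : E))).topologicalClosure := by
    set U := Submodule.span ℂ (Set.range fun k => (u k : E))
    have hV : ⨆ i, jointEigenspace A B G i ≤ U.comap D.subtype := by
      refine iSup_le fun i v hv => ?_
      have hmem : (⟨v, hv⟩ : jointEigenspace A B G i) ∈
          Submodule.span ℂ (Set.range (stdOrthonormalBasis ℂ (jointEigenspace A B G i))) := by
        rw [← OrthonormalBasis.coe_toBasis, Module.Basis.span_eq]; trivial
      have hle : Submodule.span ℂ (Set.range (stdOrthonormalBasis ℂ (jointEigenspace A B G i))) ≤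
          (U.comap D.subtype).comap (jointEigenspace A B G i).subtype := by
        rw [Submodule.span_le]
        rintro _ ⟨l, rfl⟩
        exact Submodule.subset_span ⟨⟨i, l⟩, rfl⟩
      exact hle hmem
    rw [← Submodule.dense_iff_topologicalClosure_eq_top.1 h.dense]
    refine Submodule.topologicalClosure_mono (Submodule.span_le.2 ?_)
    rintro _ ⟨v, a, rfl, hv, -⟩
    have := h.finiteDimensional_eigenspace a
    exact hV (hBG.eigenspace_le_iSup hAB hAG a (mem_eigenspace_iff.2 hv))
  exact ⟨HilbertBasis.mk ho hsp, u, fun k => ⟨Subtype.mem _, by rw [HilbertBasis.coe_mk]⟩⟩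

end IsGibbsOperator

end Joint

/-! ### The trace and the supertrace as sums over sectors -/

section Sums

variable {E : Type*} [NormedAddCommGroup E] [InnerProductSpace ℂ E] {D : Submodule ℂ E}

theorem tsum_sigma_fin {ι 𝕜 : Type*} [NormedField 𝕜] [CompleteSpace 𝕜] (m : ι → ℕ) (g : ι → 𝕜)
    (hs : Summable fun k : Σ i, Fin (m i) => g k.1) :
    ∑' k : Σ i, Fin (m i), g k.1 = ∑' i, g i * m i := by
  rw [hs.tsum_sigma]
  simp [tsum_fintype, mul_comm]

/-- **Peierls' inequality** for a unit vector: Jensen's inequality for the convex function `e^{-x}`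
and the spectral distribution of `A` in the state `x`. -/
theorem exp_neg_le_tsum {κ : Type*} {A : Module.End ℂ D} (hA : A.IsSymmetric)
    (f : HilbertBasis κ ℂ E) (v : κ → D) (hfv : ∀ k, f k = v k) (a : κ → ℝ)
    (hv : ∀ k, A (v k) = (a k : ℂ) • v k) (x : D) (hx : ‖(x : E)‖ = 1)
    (hs : Summable fun k => Real.exp (-a k) * ‖⟪f k, (x : E)⟫_ℂ‖ ^ 2) :
    Real.exp (-(⟪(x : E), (A x : E)⟫_ℂ).re) ≤
      ∑' k, Real.exp (-a k) * ‖⟪f k, (x : E)⟫_ℂ‖ ^ 2 := by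
  set m := (⟪(x : E), (A x : E)⟫_ℂ).re with hm
  have h1 : HasSum (fun k => ‖⟪f k, (x : E)⟫_ℂ‖ ^ 2) 1 := by
    simpa [hx] using hasSum_norm_inner_sq f (x : E)
  have h2 : HasSum (fun k => a k * ‖⟪f k, (x : E)⟫_ℂ‖ ^ 2) m := by
    refine (Complex.hasSum_re (f.hasSum_inner_mul_inner (x : E) (A x : E))).congr_fun fun k => ?_
    have : ⟪f k, (A x : E)⟫_ℂ = a k * ⟪f k, (x : E)⟫_ℂ := by
      have := hA (v k) x
      rw [hv, inner_smul_left, Complex.conj_ofReal] at this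
      rw [hfv]; exact this.symm
    rw [this, mul_left_comm, ← inner_conj_symm (x : E) (f k), ← Complex.normSq_eq_conj_mul_self,
      Complex.normSq_eq_norm_sq, ← Complex.ofReal_mul, Complex.ofReal_re]
  -- the tangent of `e^{-x}` at the mean value `m`
  have h3 : HasSum (fun k => Real.exp (-m) * (‖⟪f k, (x : E)⟫_ℂ‖ ^ 2 -
      (a k * ‖⟪f k, (x : E)⟫_ℂ‖ ^ 2 - m * ‖⟪f k, (x : E)⟫_ℂ‖ ^ 2))) (Real.exp (-m)) := by
    have := (h1.sub (h2.sub (h1.mul_left m))).mul_left (Real.exp (-m))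
    simpa using this
  refine hasSum_le (fun k => ?_) h3 hs.hasSum
  have ht : Real.exp (-m) * (1 - (a k - m)) ≤ Real.exp (-a k) := by
    have := Real.add_one_le_exp (-(a k - m))
    calc Real.exp (-m) * (1 - (a k - m)) ≤ Real.exp (-m) * Real.exp (-(a k - m)) := by
          gcongr; linarith
      _ = Real.exp (-a k) := by rw [← Real.exp_add]; ring_nf
  calc _ = Real.exp (-m) * (1 - (a k - m)) * ‖⟪f k, (x : E)⟫_ℂ‖ ^ 2 := by ring
    _ ≤ _ := by gcongr

namespace IsGibbsOperator

variable [CompleteSpace E] {T : E →L[ℂ] E} {A B G : Module.End ℂ D}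

theorem summable_exp (h : IsGibbsOperator A T) {κ : Type*} {v : κ → D}
    (ho : Orthonormal ℂ fun k => (v k : E)) {a : κ → ℝ} (hv : ∀ k, A (v k) = (a k : ℂ) • v k) :
    Summable fun k => Real.exp (-a k) := by
  refine (summable_inner_of_orthonormal h.nonneg h.traceClass ho).congr fun k => ?_
  rw [h.apply_eigenvector (hv k), inner_smul_right, inner_self_eq_norm_sq_to_K, ho.1 k,
    RCLike.ofReal_one, one_pow, mul_one, Complex.ofReal_re]

theorem summable_basis (h : IsGibbsOperator A T) (hBG : IsSectorPair B G)
    (hAB : Commute A B) (hAG : Commute A G) :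
    Summable fun k : Σ i, Fin (multiplicity A B G i) => Real.exp (-k.1.2) := by
  obtain ⟨f, v, hfv⟩ := h.exists_hilbertBasis hBG hAB hAG
  refine h.summable_exp (v := v) ?_ fun k => (mem_jointEigenspace.1 (hfv k).1).1
  simpa only [← (hfv _).2] using f.orthonormal

theorem summable_multiplicity (h : IsGibbsOperator A T) (hBG : IsSectorPair B G)
    (hAB : Commute A B) (hAG : Commute A G) :
    Summable fun i => Real.exp (-i.2) * multiplicity A B G i := by
  refine (h.summable_basis hBG hAB hAG).sigma.congr fun i => ?_
  simp [tsum_fintype, mul_comm]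

/-- The trace of `Λ e^{-A}`, for an operator `Λ` that acts on `D` as a function `c` of the parity `G`:
with `c = 1` this is the partition function, with `c ε = ε` the index. -/
theorem trace_comp_eq (h : IsGibbsOperator A T) (hBG : IsSectorPair B G)
    (hAB : Commute A B) (hAG : Commute A G) (Λ : E →L[ℂ] E) (c : ℤˣ → ℂ) (hc : ∀ ε, ‖c ε‖ ≤ 1)
    (hΛ : ∀ (v : D) (ε : ℤˣ), G v = ((ε : ℤ) : ℂ) • v → Λ v = c ε • (v : E)) :
    trace (Λ ∘L T) = ∑' i, c i.1.2 * (Real.exp (-i.2) : ℂ) * multiplicity A B G i := by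
  obtain ⟨f, v, hfv⟩ := h.exists_hilbertBasis hBG hAB hAG
  have hs : Summable fun k : Σ i, Fin (multiplicity A B G i) =>
      c k.1.1.2 * (Real.exp (-k.1.2) : ℂ) := by
    refine Summable.of_norm_bounded (h.summable_basis hBG hAB hAG) fun k => ?_
    rw [norm_mul, Complex.norm_real, Real.norm_of_nonneg (Real.exp_pos _).le]
    exact mul_le_of_le_one_left (Real.exp_pos _).le (hc _)
  rw [trace_eq_tsum_of_diagonal f _ (fun k => c k.1.1.2 * (Real.exp (-k.1.2) : ℂ)) (fun k => ?_) hs,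
    tsum_sigma_fin (multiplicity A B G) (fun i => c i.1.2 * (Real.exp (-i.2) : ℂ)) hs]
  have hk := mem_jointEigenspace.1 (hfv k).1
  rw [(hfv k).2, ContinuousLinearMap.comp_apply, h.apply_eigenvector hk.1, map_smul,
    hΛ _ _ hk.2.2, smul_smul, mul_comm]

theorem trace_eq (h : IsGibbsOperator A T) (hBG : IsSectorPair B G)
    (hAB : Commute A B) (hAG : Commute A G) :
    trace T = ((∑' i, Real.exp (-i.2) * multiplicity A B G i : ℝ) : ℂ) := by
  have := h.trace_comp_eq hBG hAB hAG (ContinuousLinearMap.id ℂ E) (fun _ => 1) (by simp)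
    (by simp)
  rw [ContinuousLinearMap.id_comp] at this
  rw [this, Complex.ofReal_tsum]
  exact tsum_congr fun i => by push_cast; ring

theorem summable_sector (h : IsGibbsOperator A T) (hBG : IsSectorPair B G)
    (hAB : Commute A B) (hAG : Commute A G) (S : Set (ℂ × ℤˣ)) :
    Summable fun i : (ℂ × ℤˣ) × ℝ =>
      S.indicator (fun _ => (1 : ℝ)) i.1 * (Real.exp (-i.2) * multiplicity A B G i) := by
  refine Summable.of_nonneg_of_le (fun i => ?_) (fun i => ?_)
    (h.summable_multiplicity hBG hAB hAG)
  · exact mul_nonneg (Set.indicator_nonneg (fun _ _ => zero_le_one) _) (by positivity)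
  · exact mul_le_of_le_one_left (by positivity) (Set.indicator_le_self' (fun _ _ => zero_le_one) _)

theorem sectorSum_add_compl (h : IsGibbsOperator A T) (hBG : IsSectorPair B G)
    (hAB : Commute A B) (hAG : Commute A G) (S : Set (ℂ × ℤˣ)) :
    sectorSum A B G S + sectorSum A B G Sᶜ = (trace T).re := by
  rw [h.trace_eq hBG hAB hAG, Complex.ofReal_re, sectorSum, sectorSum,
    ← (h.summable_sector hBG hAB hAG S).tsum_add (h.summable_sector hBG hAB hAG Sᶜ)]
  refine tsum_congr fun i => ?_
  rw [← add_mul, Set.indicator_self_add_compl_apply, one_mul]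

/-- The sector sum as a sum over the basis vectors instead of the joint eigenvalues. -/
theorem hasSum_sectorSum (h : IsGibbsOperator A T) (hBG : IsSectorPair B G)
    (hAB : Commute A B) (hAG : Commute A G) (S : Set (ℂ × ℤˣ)) :
    HasSum (fun k : Σ i, Fin (multiplicity A B G i) =>
      S.indicator (fun _ => (1 : ℝ)) k.1.1 * Real.exp (-k.1.2)) (sectorSum A B G S) := by
  have hs : Summable fun k : Σ i, Fin (multiplicity A B G i) =>
      S.indicator (fun _ => (1 : ℝ)) k.1.1 * Real.exp (-k.1.2) := by
    refine Summable.of_nonneg_of_le (fun k => ?_) (fun k => ?_) (h.summable_basis hBG hAB hAG)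
    · exact mul_nonneg (Set.indicator_nonneg (fun _ _ => zero_le_one) _) (by positivity)
    · exact mul_le_of_le_one_left (by positivity)
        (Set.indicator_le_self' (fun _ _ => zero_le_one) _)
  have := tsum_sigma_fin (multiplicity A B G)
    (fun i : (ℂ × ℤˣ) × ℝ => S.indicator (fun _ => (1 : ℝ)) i.1 * Real.exp (-i.2)) hs
  rw [sectorSum]
  simp only [← mul_assoc]
  exact this ▸ hs.hasSum

/-- **Peierls' inequality** in a set `S` of sectors. -/
theorem sum_exp_neg_le_sectorSum (h : IsGibbsOperator A T) (hBG : IsSectorPair B G)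
    (hAB : Commute A B) (hAG : Commute A G) {S : Set (ℂ × ℤˣ)} {κ : Type*} (F : Finset κ)
    (e : κ → D) (he : Orthonormal ℂ fun k => (e k : E)) (j : κ → ℂ × ℤˣ)
    (hj : ∀ k ∈ F, j k ∈ S)
    (hej : ∀ k, B (e k) = (j k).1 • e k ∧ G (e k) = (((j k).2 : ℤ) : ℂ) • e k) :
    ∑ k ∈ F, Real.exp (-(⟪(e k : E), (A (e k) : E)⟫_ℂ).re) ≤ sectorSum A B G S := by
  obtain ⟨f, v, hfv⟩ := h.exists_hilbertBasis hBG hAB hAG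
  have hv (l) := mem_jointEigenspace.1 (hfv l).1
  have hbound (k : κ) (l : Σ i, Fin (multiplicity A B G i)) : ‖⟪f l, (e k : E)⟫_ℂ‖ ≤ 1 := by
    simpa [f.orthonormal.1 l, he.1 k] using norm_inner_le_norm (𝕜 := ℂ) (f l) (e k : E)
  have hs (k : κ) : Summable fun l : Σ i, Fin (multiplicity A B G i) =>
      Real.exp (-l.1.2) * ‖⟪f l, (e k : E)⟫_ℂ‖ ^ 2 :=
    Summable.of_nonneg_of_le (fun l => by positivity)
      (fun l => mul_le_of_le_one_right (Real.exp_pos _).le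
        (pow_le_one₀ (norm_nonneg _) (hbound k l))) (h.summable_basis hBG hAB hAG)
  calc ∑ k ∈ F, Real.exp (-(⟪(e k : E), (A (e k) : E)⟫_ℂ).re)
      ≤ ∑ k ∈ F, ∑' l : Σ i, Fin (multiplicity A B G i),
          Real.exp (-l.1.2) * ‖⟪f l, (e k : E)⟫_ℂ‖ ^ 2 :=
        Finset.sum_le_sum fun k _ => exp_neg_le_tsum h.symm f v (fun l => (hfv l).2)
          (fun l => l.1.2) (fun l => (hv l).1) (e k) (he.1 k) (hs k)
    _ = ∑' l : Σ i, Fin (multiplicity A B G i),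
          ∑ k ∈ F, Real.exp (-l.1.2) * ‖⟪f l, (e k : E)⟫_ℂ‖ ^ 2 :=
        (Summable.tsum_finsetSum fun k _ => hs k).symm
    _ ≤ sectorSum A B G S := by
        refine hasSum_le (fun l => ?_) (summable_sum fun k _ => hs k).hasSum
          (h.hasSum_sectorSum hBG hAB hAG S)
        rw [← Finset.mul_sum, mul_comm]
        by_cases hl : l.1.1 ∈ S
        · rw [Set.indicator_of_mem hl]
          refine mul_le_mul_of_nonneg_right ?_ (Real.exp_pos _).le
          -- Bessel's inequality
          have := he.sum_inner_products_le (f l) (s := F)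
          rw [f.orthonormal.1 l, one_pow] at this
          simpa only [norm_inner_symm] using this
        · rw [Set.indicator_of_notMem hl, zero_mul]
          refine (mul_eq_zero_of_left (Finset.sum_eq_zero fun k hk => ?_) _).le
          have hne : l.1.1 ≠ j k := fun hh => hl (by rw [hh]; exact hj k hk)
          rw [(hfv l).2, hBG.inner_eq_zero hne (hv l).2 (hej k)]
          simp

end IsGibbsOperator

end Sums

/-! ### The pairing of states by a supercharge -/

section Pairing

variable {E : Type*} [NormedAddCommGroup E] [InnerProductSpace ℂ E] {D : Submodule ℂ E}

/-- `𝒬` is a supercharge for `A` and the fermion parity `G`, with central element `B`: it commutes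
with `A`, anticommutes with `G`, and its square is `c (A - B)` with `c ≠ 0`. -/
structure IsSupercharge (A B G 𝒬 : Module.End ℂ D) (c : ℂ) : Prop where
  ne_zero : c ≠ 0
  sq : 𝒬 * 𝒬 = c • (A - B)
  comm : Commute A 𝒬
  comm_parity : Commute A G
  anticomm : 𝒬 * G = -(G * 𝒬)

namespace IsSupercharge

variable {A B G 𝒬 : Module.End ℂ D} {c : ℂ}

theorem eq_sub (h : IsSupercharge A B G 𝒬 c) : B = A - c⁻¹ • (𝒬 * 𝒬) := by
  rw [h.sq, smul_smul, inv_mul_cancel₀ h.ne_zero, one_smul, sub_sub_cancel]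

theorem commute_left (h : IsSupercharge A B G 𝒬 c) : Commute A B := by
  rw [h.eq_sub]
  exact (Commute.refl A).sub_right ((h.comm.mul_right h.comm).smul_right _)

theorem commute_charge (h : IsSupercharge A B G 𝒬 c) : Commute B 𝒬 := by
  rw [h.eq_sub]
  exact h.comm.sub_left
    (((Commute.refl 𝒬).mul_left (Commute.refl 𝒬)).smul_left _)

theorem commute_parity (h : IsSupercharge A B G 𝒬 c) : Commute B G := by
  rw [h.eq_sub]
  refine h.comm_parity.sub_left (Commute.smul_left ?_ _)
  have hG (v : D) : 𝒬 (G v) = -G (𝒬 v) := LinearMap.congr_fun h.anticomm v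
  refine LinearMap.ext fun v => ?_
  change 𝒬 (𝒬 (G v)) = G (𝒬 (𝒬 v))
  rw [hG, map_neg, hG, neg_neg]

theorem mem_jointEigenspace_neg (h : IsSupercharge A B G 𝒬 c) {b : ℂ} {ε : ℤˣ} {a : ℝ} {v : D}
    (hv : v ∈ jointEigenspace A B G ((b, ε), a)) :
    𝒬 v ∈ jointEigenspace A B G ((b, -ε), a) := by
  rw [mem_jointEigenspace] at hv ⊢
  obtain ⟨h1, h2, h3⟩ := hv
  have hA : A (𝒬 v) = 𝒬 (A v) := LinearMap.congr_fun h.comm v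
  have hB : B (𝒬 v) = 𝒬 (B v) := LinearMap.congr_fun h.commute_charge v
  have hG : 𝒬 (G v) = -G (𝒬 v) := LinearMap.congr_fun h.anticomm v
  refine ⟨by rw [hA, h1, map_smul], by rw [hB, h2, map_smul], ?_⟩
  rw [← neg_eq_iff_eq_neg.2 hG, h3, map_smul]
  simp

theorem multiplicity_le (h : IsSupercharge A B G 𝒬 c) {b : ℂ} {ε : ℤˣ} {a : ℝ} (hab : (a : ℂ) ≠ b)
    [FiniteDimensional ℂ (jointEigenspace A B G ((b, -ε), a))] :
    multiplicity A B G ((b, ε), a) ≤ multiplicity A B G ((b, -ε), a) := by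
  refine LinearMap.finrank_le_finrank_of_injective
    (f := 𝒬.restrict fun v hv => h.mem_jointEigenspace_neg hv) ?_
  rw [← LinearMap.ker_eq_bot, LinearMap.ker_eq_bot']
  rintro ⟨v, hv⟩ h0
  have h0 : 𝒬 v = 0 := congrArg Subtype.val h0
  have hv' := mem_jointEigenspace.1 hv
  have hsq : 𝒬 (𝒬 v) = c • (A v - B v) := LinearMap.congr_fun h.sq v
  rw [h0, map_zero, hv'.1, hv'.2.1, ← sub_smul, smul_smul, eq_comm, smul_eq_zero] at hsq
  exact Subtype.ext (hsq.resolve_left (mul_ne_zero h.ne_zero (sub_ne_zero.2 hab)))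

/-- Away from `A = B` the supercharge maps bosonic states bijectively to fermionic ones. -/
theorem multiplicity_eq [CompleteSpace E] {T : E →L[ℂ] E} (h : IsSupercharge A B G 𝒬 c)
    (hT : IsGibbsOperator A T) {b : ℂ} {a : ℝ} (hab : (a : ℂ) ≠ b) :
    multiplicity A B G ((b, 1), a) = multiplicity A B G ((b, -1), a) := by
  have hfin (i) := hT.finiteDimensional_jointEigenspace (B := B) (G := G) i
  refine (h.multiplicity_le hab).antisymm ?_
  simpa using h.multiplicity_le (ε := -1) hab

end IsSupercharge

/-- The number of bosonic minus the number of fermionic states with `A = B = λ`. The label `λ` is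
complex, as an eigenvalue of `B`; only real `λ` occur, for which `A = re λ` is the same condition. -/
def bpsIndex (A B G : Module.End ℂ D) (b : ℂ) : ℤ :=
  multiplicity A B G ((b, 1), b.re) - multiplicity A B G ((b, -1), b.re)

namespace IsGibbsOperator

variable [CompleteSpace E] {T : E →L[ℂ] E} {A B G 𝒬 : Module.End ℂ D} {c : ℂ}

theorem sectorSum_singleton (h : IsGibbsOperator A T) (hBG : IsSectorPair B G)
    (hAB : Commute A B) (hAG : Commute A G) (j : ℂ × ℤˣ) :
    sectorSum A B G {j} = ∑' a : ℝ, Real.exp (-a) * multiplicity A B G (j, a) := by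
  rw [sectorSum, (h.summable_sector hBG hAB hAG {j}).tsum_prod, tsum_eq_single j]
  · simp
  · intro l hl
    simp [Set.indicator_of_notMem (Set.notMem_singleton_iff.2 hl)]

theorem sectorSum_sub (h : IsGibbsOperator A T) (hBG : IsSectorPair B G)
    (h𝒬 : IsSupercharge A B G 𝒬 c) (b : ℂ) :
    sectorSum A B G {(b, 1)} - sectorSum A B G {(b, -1)} =
      Real.exp (-b.re) * bpsIndex A B G b := by
  have hs (j : ℂ × ℤˣ) : Summable fun a : ℝ => Real.exp (-a) * multiplicity A B G (j, a) :=
    (h.summable_multiplicity hBG h𝒬.commute_left h𝒬.comm_parity).prod_factor j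
  rw [h.sectorSum_singleton hBG h𝒬.commute_left h𝒬.comm_parity,
    h.sectorSum_singleton hBG h𝒬.commute_left h𝒬.comm_parity, ← (hs _).tsum_sub (hs _),
    tsum_eq_single b.re]
  · simp [bpsIndex, mul_sub]
  · intro a ha
    have hab : (a : ℂ) ≠ b := by
      rintro rfl
      exact ha rfl
    rw [h𝒬.multiplicity_eq h hab, sub_self]

/-- Only the states with `A = B` contribute to the index. -/
theorem trace_parity_comp (h : IsGibbsOperator A T) (hBG : IsSectorPair B G)
    (h𝒬 : IsSupercharge A B G 𝒬 c) (Γ : E →L[ℂ] E) (hΓ : ∀ v : D, (G v : E) = Γ v) :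
    trace (Γ ∘L T) = ∑' b : ℂ, (Real.exp (-b.re) : ℂ) * bpsIndex A B G b := by
  have hAB := h𝒬.commute_left
  have hAG := h𝒬.comm_parity
  have hs : Summable fun i : (ℂ × ℤˣ) × ℝ =>
      ((i.1.2 : ℤ) : ℝ) * (Real.exp (-i.2) * multiplicity A B G i) := by
    refine Summable.of_norm_bounded (h.summable_multiplicity hBG hAB hAG) fun i => ?_
    rw [norm_mul, Real.norm_of_nonneg (by positivity : 0 ≤ Real.exp (-i.2) * _)]
    rcases Int.units_eq_one_or i.1.2 with hi | hi <;> simp [hi]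
  have hs' : Summable fun j : ℂ × ℤˣ => ((j.2 : ℤ) : ℝ) * sectorSum A B G {j} := by
    refine hs.prod.congr fun j => ?_
    rw [h.sectorSum_singleton hBG hAB hAG, ← tsum_mul_left]
  have hreal : ∑' i : (ℂ × ℤˣ) × ℝ, ((i.1.2 : ℤ) : ℝ) * (Real.exp (-i.2) * multiplicity A B G i) =
      ∑' b : ℂ, Real.exp (-b.re) * bpsIndex A B G b := by
    calc _ = ∑' j : ℂ × ℤˣ, ((j.2 : ℤ) : ℝ) * sectorSum A B G {j} := by
          rw [hs.tsum_prod]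
          exact tsum_congr fun j => by
            rw [h.sectorSum_singleton hBG hAB hAG, ← tsum_mul_left]
      _ = ∑' b : ℂ, ∑' ε : ℤˣ, ((ε : ℤ) : ℝ) * sectorSum A B G {(b, ε)} := hs'.tsum_prod
      _ = _ := tsum_congr fun b => by
          rw [← h.sectorSum_sub hBG h𝒬, tsum_fintype, UnitsInt.univ,
            Finset.sum_pair (by decide)]
          push_cast
          ring
  rw [h.trace_comp_eq hBG hAB hAG Γ (fun ε => ((ε : ℤ) : ℂ)) (fun ε => ?_) fun v ε hv => ?_]
  · calc _ = ((∑' i : (ℂ × ℤˣ) × ℝ,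
          ((i.1.2 : ℤ) : ℝ) * (Real.exp (-i.2) * multiplicity A B G i) : ℝ) : ℂ) := by
          rw [Complex.ofReal_tsum]
          exact tsum_congr fun i => by push_cast; ring
      _ = _ := by
          rw [hreal, Complex.ofReal_tsum]
          exact tsum_congr fun b => by push_cast; ring
  · rcases Int.units_eq_one_or ε with rfl | rfl <;> simp
  · rw [← hΓ, hv]; rfl

end IsGibbsOperator

end Pairing

/-! ### Deformations -/

section Deformation

variable {E : Type*} [NormedAddCommGroup E] [InnerProductSpace ℂ E] [CompleteSpace E]
  {D : Submodule ℂ E} {A 𝒬 : ℝ → Module.End ℂ D} {B G : Module.End ℂ D} {T : ℝ → E →L[ℂ] E}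
  {s : Set ℝ} {c : ℂ}

/-- Peierls' inequality for `A γ`, applied to eigenvectors of `A γ₀`, bounds the sector sums from
below by quantities that are continuous in `γ`. -/
theorem lowerSemicontinuousOn_sectorSum (hT : ∀ γ ∈ s, IsGibbsOperator (A γ) (T γ))
    (hBG : IsSectorPair B G) (hAB : ∀ γ ∈ s, Commute (A γ) B) (hAG : ∀ γ ∈ s, Commute (A γ) G)
    (hcont : ∀ φ ψ : D, ContinuousOn (fun γ => ⟪(φ : E), (A γ ψ : E)⟫_ℂ) s)
    (S : Set (ℂ × ℤˣ)) : LowerSemicontinuousOn (fun γ => sectorSum (A γ) B G S) s := by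
  classical
  intro γ₀ hγ₀ t ht
  obtain ⟨f, v, hfv⟩ := (hT γ₀ hγ₀).exists_hilbertBasis hBG (hAB γ₀ hγ₀) (hAG γ₀ hγ₀)
  have hv (k) := mem_jointEigenspace.1 (hfv k).1
  have ho : Orthonormal ℂ fun k => (v k : E) := by
    simpa only [← (hfv _).2] using f.orthonormal
  obtain ⟨F, hF⟩ := (((hT γ₀ hγ₀).hasSum_sectorSum hBG (hAB γ₀ hγ₀) (hAG γ₀ hγ₀) S).eventually
    (lt_mem_nhds ht)).exists
  have hcF : ContinuousOn (fun γ => ∑ k ∈ F with k.1.1 ∈ S,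
      Real.exp (-(⟪(v k : E), (A γ (v k) : E)⟫_ℂ).re)) s := by
    refine continuousOn_finsetSum _ fun k _ => ?_
    exact Real.continuous_exp.comp_continuousOn
      (Complex.continuous_re.comp_continuousOn (hcont _ _)).neg
  have hF' : t < ∑ k ∈ F with k.1.1 ∈ S,
      Real.exp (-(⟪(v k : E), (A γ₀ (v k) : E)⟫_ℂ).re) := by
    refine hF.trans_eq ?_
    rw [Finset.sum_filter]
    refine Finset.sum_congr rfl fun k _ => ?_
    have : (⟪(v k : E), (A γ₀ (v k) : E)⟫_ℂ).re = k.1.2 := by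
      rw [(hv k).1, Submodule.coe_smul, inner_smul_right, inner_self_eq_norm_sq_to_K, ho.1 k,
        RCLike.ofReal_one, one_pow, mul_one, Complex.ofReal_re]
    simp only [this, Set.indicator_apply, ite_mul, one_mul, zero_mul]
  filter_upwards [(hcF γ₀ hγ₀).eventually (lt_mem_nhds hF'), self_mem_nhdsWithin] with γ h1 hγ
  refine h1.trans_le ((hT γ hγ).sum_exp_neg_le_sectorSum hBG (hAB γ hγ) (hAG γ hγ) _ v ho
    (fun k => k.1.1) (fun k hk => (Finset.mem_filter.1 hk).2) fun k => (hv k).2)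

/-- The contributions of `S` and of its complement are lower semicontinuous with continuous sum,
hence continuous. -/
theorem continuousOn_sectorSum (hT : ∀ γ ∈ s, IsGibbsOperator (A γ) (T γ))
    (hBG : IsSectorPair B G) (hAB : ∀ γ ∈ s, Commute (A γ) B) (hAG : ∀ γ ∈ s, Commute (A γ) G)
    (hcont : ∀ φ ψ : D, ContinuousOn (fun γ => ⟪(φ : E), (A γ ψ : E)⟫_ℂ) s)
    (htr : ContinuousOn (fun γ => trace (T γ)) s) (S : Set (ℂ × ℤˣ)) :
    ContinuousOn (fun γ => sectorSum (A γ) B G S) s := by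
  intro γ₀ hγ₀
  have hadd (γ) (hγ : γ ∈ s) :=
    (hT γ hγ).sectorSum_add_compl hBG (hAB γ hγ) (hAG γ hγ) S
  refine tendsto_order.2 ⟨fun t ht =>
    lowerSemicontinuousOn_sectorSum hT hBG hAB hAG hcont S γ₀ hγ₀ t ht, fun t ht => ?_⟩
  have htr' := (Complex.continuous_re.comp_continuousOn htr) γ₀ hγ₀
  have h1 := htr'.eventually (gt_mem_nhds
    (show (trace (T γ₀)).re < (trace (T γ₀)).re + (t - sectorSum (A γ₀) B G S) / 2 by linarith))
  have h2 := lowerSemicontinuousOn_sectorSum hT hBG hAB hAG hcont Sᶜ γ₀ hγ₀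
    (sectorSum (A γ₀) B G Sᶜ - (t - sectorSum (A γ₀) B G S) / 2) (by dsimp only; linarith)
  filter_upwards [h1, h2, self_mem_nhdsWithin] with γ h1 h2 hγ
  have h3 := hadd γ hγ
  have h4 := hadd γ₀ hγ₀
  simp only [Function.comp_apply] at h1
  linarith

/-- **Invariance of the index** of a family with a supercharge `𝒬 γ` and a central element `B` that
does not depend on `γ`. -/
theorem trace_parity_comp_eq (hs : s.OrdConnected) (hT : ∀ γ ∈ s, IsGibbsOperator (A γ) (T γ))
    (hB : B.IsSymmetric) (hG : G.IsSymmetric) (hGsq : G * G = 1)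
    (h𝒬 : ∀ γ ∈ s, IsSupercharge (A γ) B G (𝒬 γ) c)
    (hcont : ∀ φ ψ : D, ContinuousOn (fun γ => ⟪(φ : E), (A γ ψ : E)⟫_ℂ) s)
    (htr : ContinuousOn (fun γ => trace (T γ)) s) (Γ : E →L[ℂ] E)
    (hΓ : ∀ v : D, (G v : E) = Γ v) {γ γ' : ℝ} (hγ : γ ∈ s) (hγ' : γ' ∈ s) :
    trace (Γ ∘L T γ) = trace (Γ ∘L T γ') := by
  have hBG : IsSectorPair B G := ⟨hB, hG, hGsq, (h𝒬 γ hγ).commute_parity⟩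
  rw [(hT γ hγ).trace_parity_comp hBG (h𝒬 γ hγ) Γ hΓ,
    (hT γ' hγ').trace_parity_comp hBG (h𝒬 γ' hγ') Γ hΓ]
  refine tsum_congr fun b => ?_
  have hc (S) := continuousOn_sectorSum hT hBG (fun γ hγ => (h𝒬 γ hγ).commute_left)
    (fun γ hγ => (h𝒬 γ hγ).comm_parity) hcont htr S
  have h1 : ContinuousOn (fun γ => (bpsIndex (A γ) B G b : ℝ)) s := by
    refine ((hc {(b, 1)}).sub (hc {(b, -1)})).const_mul (Real.exp b.re) |>.congr fun γ hγ => ?_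
    simp only [Pi.sub_apply]
    rw [(hT γ hγ).sectorSum_sub hBG (h𝒬 γ hγ) b, ← mul_assoc, ← Real.exp_add, add_neg_cancel,
      Real.exp_zero, one_mul]
  have h2 : ContinuousOn (fun γ => bpsIndex (A γ) B G b) s :=
    Int.isClosedEmbedding_coe_real.isInducing.continuousOn_iff.2 h1
  rw [hs.isPreconnected.constant h2 hγ hγ']

end Deformation

/-! ### The operators `e^{-βH}` and `e^{-βH} e^K` -/

section Exponential

variable {E : Type*} [NormedAddCommGroup E] [InnerProductSpace ℂ E] {D : Submodule ℂ E}

theorem toBounded_apply {r : E → E → Prop} (hr : IsBoundedRel r) {x y : E} (h : r x y) :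
    toBounded r x = y := by
  rw [toBounded, dif_pos hr]
  exact hr.choose_spec x y h

theorem expRel_eigenvector {A : Module.End ℂ D} (hA : A.IsSymmetric) {v : D} {a : ℝ}
    (hv : A v = (a : ℂ) • v) (z : ℂ) : expRel A (z • v) ((Real.exp a : ℂ) • z • (v : E)) := by
  intro w b hw
  rw [inner_smul_right]
  by_cases hab : b = a
  · rw [hab]
  · rw [inner_smul_right, inner_eq_zero_of_eigenvalue_ne hA hw hv
      (fun hh => hab (Complex.ofReal_injective hh)), mul_zero, mul_zero, mul_zero]

theorem isSymmetric_ofReal_smul {A : Module.End ℂ D} (hA : A.IsSymmetric) (c : ℝ) :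
    ((c : ℂ) • A).IsSymmetric :=
  hA.smul (Complex.conj_ofReal c)

theorem smul_apply_eigenvector {A : Module.End ℂ D} {v : D} {a : ℝ} (hv : A v = (a : ℂ) • v)
    (c : ℝ) : ((c : ℂ) • A) v = ((c * a : ℝ) : ℂ) • v := by
  rw [LinearMap.smul_apply, hv, smul_smul, Complex.ofReal_mul]

theorem boltzmann_eigenvector {H : Module.End ℂ D} (hH : H.IsSymmetric) (β : ℝ) {v : D} {a : ℝ}
    (hv : H v = (a : ℂ) • v) (z : ℂ) :
    boltzmann β H (z • v) ((Real.exp (-(β * a)) : ℂ) • z • (v : E)) := by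
  rw [boltzmann, ← Complex.ofReal_neg, ← neg_mul]
  exact expRel_eigenvector (isSymmetric_ofReal_smul hH (-β)) (smul_apply_eigenvector hv (-β)) z

variable [CompleteSpace E]

/-- The bounded extension of the operator with graph `e^{-βH}` is a Gibbs operator of `βH`. -/
theorem isGibbsOperator_boltzmann {H : Module.End ℂ D} (hH : H.IsSymmetric) (β : ℝ)
    (hd : HasCompleteEigenstates {H}) (ht : IsTraceClassRel (boltzmann β H)) :
    IsGibbsOperator ((β : ℂ) • H) (toBounded (boltzmann β H)) where
  symm := isSymmetric_ofReal_smul hH β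
  traceClass := ht.2
  dense := by
    refine hd.mono (Submodule.span_mono ?_)
    rintro _ ⟨v, rfl, hv⟩
    obtain ⟨a, ha⟩ := hv H rfl
    refine ⟨v, β * a, rfl, smul_apply_eigenvector ha β, toBounded_apply ht.1 ?_⟩
    simpa using boltzmann_eigenvector hH β ha 1

/-- On joint eigenvectors of `H` and `K = ∑ μ_j M_j` the product `e^{-βH} e^K` acts as
`e^{-(βH - K)}`. -/
theorem isGibbsOperator_genBoltzmann {H : Module.End ℂ D} (hH : H.IsSymmetric) (β : ℝ) {n : ℕ}
    (μ : Fin n → ℝ) (M : Fin n → Module.End ℂ D) (hK : (∑ j, (μ j : ℂ) • M j).IsSymmetric)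
    (hd : HasCompleteEigenstates {H, ∑ j, (μ j : ℂ) • M j})
    (ht : IsTraceClassRel (genBoltzmann β H μ M)) :
    IsGibbsOperator ((β : ℂ) • H - ∑ j, (μ j : ℂ) • M j) (toBounded (genBoltzmann β H μ M)) where
  symm := (isSymmetric_ofReal_smul hH β).sub hK
  traceClass := ht.2
  dense := by
    refine hd.mono (Submodule.span_mono ?_)
    rintro _ ⟨v, rfl, hv⟩
    obtain ⟨a, ha⟩ := hv H (Set.mem_insert _ _)
    obtain ⟨k, hk⟩ := hv (∑ j, (μ j : ℂ) • M j) (Set.mem_insert_of_mem _ rfl)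
    refine ⟨v, β * a - k, rfl, ?_, toBounded_apply ht.1 ⟨(Real.exp k : ℂ) • (v : E), ?_, ?_⟩⟩
    · rw [LinearMap.sub_apply, hk, smul_apply_eigenvector ha, ← sub_smul, ← Complex.ofReal_sub]
    · simpa using expRel_eigenvector hK hk 1
    · have := boltzmann_eigenvector hH β ha (Real.exp k)
      rwa [smul_smul, ← Complex.ofReal_mul, ← Real.exp_add,
        show -(β * a) + k = -(β * a - k) by ring] at this

end Exponential

/-! ### The weak supersymmetry algebra -/

section Algebra

variable {E : Type*} [NormedAddCommGroup E] [InnerProductSpace ℂ E] {D : Submodule ℂ E}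
  {Γ : E →L[ℂ] E}

namespace IsFermionParity

/-- The restriction of `(-1)^F` to the common domain. -/
def restrict (hΓ : IsFermionParity D Γ) : Module.End ℂ D :=
  LinearMap.restrict (Γ : E →ₗ[ℂ] E) hΓ.mem

theorem coe_restrict (hΓ : IsFermionParity D Γ) (v : D) : (hΓ.restrict v : E) = Γ v := rfl

theorem restrict_isSymmetric (hΓ : IsFermionParity D Γ) : hΓ.restrict.IsSymmetric :=
  fun x y => hΓ.symm x y

theorem restrict_sq (hΓ : IsFermionParity D Γ) : hΓ.restrict * hΓ.restrict = 1 :=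
  LinearMap.ext fun v => Subtype.ext (hΓ.sq v)

theorem commute_of_isEven (hΓ : IsFermionParity D Γ) {A : Module.End ℂ D} (hA : IsEven Γ A) :
    Commute A hΓ.restrict :=
  LinearMap.ext fun v => Subtype.ext (hA v (hΓ.restrict v) rfl)

theorem mul_restrict_of_isOdd (hΓ : IsFermionParity D Γ) {A : Module.End ℂ D} (hA : IsOdd Γ A) :
    A * hΓ.restrict = -(hΓ.restrict * A) :=
  LinearMap.ext fun v => Subtype.ext (hA v (hΓ.restrict v) rfl)

end IsFermionParity

/-- The value `R/ρ - ∑ (σ_a)_α^α P_a` of the Hamiltonian on the states that are annihilated by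
`Q_α` and `Q̄^α`. -/
def bpsHamiltonian (ρ : ℝ) (P : Fin 3 → Module.End ℂ D) (R : Module.End ℂ D) (α : Fin 2) :
    Module.End ℂ D :=
  (1 / (ρ : ℂ)) • R - ∑ a, pauli a α α • P a

theorem conj_pauli_diag (a : Fin 3) (α : Fin 2) :
    (starRingEnd ℂ) (pauli a α α) = pauli a α α := by
  fin_cases a <;> fin_cases α <;> simp [pauli]

namespace WeakSUSYAlgebra

variable {ρ : ℝ} {P : Fin 3 → Module.End ℂ D} {R H : Module.End ℂ D}
  {Q Qbar : Fin 2 → Module.End ℂ D}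

theorem isSymmetric_bpsHamiltonian (h : WeakSUSYAlgebra Γ ρ P R Q Qbar H) (α : Fin 2) :
    (bpsHamiltonian ρ P R α).IsSymmetric := by
  refine LinearMap.IsSymmetric.sub (LinearMap.IsSymmetric.smul (by simp) h.herm_R) ?_
  refine LinearMap.isSymmetric_sum _ fun a _ => ?_
  exact LinearMap.IsSymmetric.smul (conj_pauli_diag a α) (h.herm_P a)

/-- `Q_α + Q̄^α` squares to `2 (H - R/ρ + ∑ (σ_a)_α^α P_a)`. -/
theorem isSupercharge (h : WeakSUSYAlgebra Γ ρ P R Q Qbar H) (hΓ : IsFermionParity D Γ) {β : ℝ}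
    (hβ : 0 < β) (α : Fin 2) {K : Module.End ℂ D} (hK : IsEven Γ K)
    (hKQ : Commute K (Q α)) (hKQbar : Commute K (Qbar α)) :
    IsSupercharge ((β : ℂ) • H - K) ((β : ℂ) • bpsHamiltonian ρ P R α - K) hΓ.restrict
      (Q α + Qbar α) (2 / β) where
  ne_zero := by simp [hβ.ne']
  sq := by
    have hβ' : (β : ℂ) ≠ 0 := by exact_mod_cast hβ.ne'
    have h0 {x : D} (hx : x + x = 0) : x = 0 := by
      rw [← two_smul ℂ x] at hx
      exact (smul_eq_zero.1 hx).resolve_left two_ne_zero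
    refine LinearMap.ext fun v => ?_
    have h1 : Q α (Q α v) = 0 := h0 (LinearMap.congr_fun (h.anticomm_Q_Q α α) v)
    have h2 : Qbar α (Qbar α v) = 0 := h0 (LinearMap.congr_fun (h.anticomm_Qbar_Qbar α α) v)
    have h3 : Q α (Qbar α v) + Qbar α (Q α v) =
        (2 : ℂ) • (H v - (1 / (ρ : ℂ)) • R v) + (2 : ℂ) • (∑ a, pauli a α α • P a) v := by
      have := LinearMap.congr_fun (h.anticomm_Q_Qbar α α) v
      rwa [if_pos rfl] at this
    have h4 : (Q α + Qbar α) ((Q α + Qbar α) v) = Q α (Qbar α v) + Qbar α (Q α v) := by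
      simp only [LinearMap.add_apply, map_add, h1, h2, zero_add, add_comm]
    change (Q α + Qbar α) ((Q α + Qbar α) v) = (2 / β : ℂ) • (((β : ℂ) • H v - K v) -
      ((β : ℂ) • ((1 / (ρ : ℂ)) • R v - (∑ a, pauli a α α • P a) v) - K v))
    rw [h4, h3, sub_sub_sub_cancel_right, ← smul_sub, smul_smul, div_mul_cancel₀ _ hβ',
      ← smul_add, sub_sub_eq_add_sub, add_sub_right_comm]
  comm := by
    have hH : Commute H (Q α + Qbar α) :=
      Commute.add_right (h.comm_Q_H α).symm (h.comm_Qbar_H α).symm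
    exact (hH.smul_left _).sub_left (hKQ.add_right hKQbar)
  comm_parity := ((hΓ.commute_of_isEven h.even_H).smul_left _).sub_left (hΓ.commute_of_isEven hK)
  anticomm := by
    rw [add_mul, hΓ.mul_restrict_of_isOdd (h.odd_Q α), hΓ.mul_restrict_of_isOdd (h.odd_Qbar α),
      mul_add, neg_add]

end WeakSUSYAlgebra

/-- The common content of both parts of the theorem: if `T γ` is a trace class realization of
`e^{-βH(γ) + K}` with continuous trace, its supertrace does not depend on `γ`. -/
theorem trace_parity_comp_eq_of_algebra [CompleteSpace E] (hΓ : IsFermionParity D Γ) {ρ : ℝ}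
    {s : Set ℝ} (hs : s.OrdConnected) {P : Fin 3 → Module.End ℂ D} {R : Module.End ℂ D}
    {Q Qbar : ℝ → Fin 2 → Module.End ℂ D} {H : ℝ → Module.End ℂ D}
    (halg : ∀ γ ∈ s, WeakSUSYAlgebra Γ ρ P R (Q γ) (Qbar γ) (H γ))
    (hcont : ∀ φ ψ : D, ContinuousOn (fun γ => ⟪(φ : E), (H γ ψ : E)⟫_ℂ) s)
    {β : ℝ} (hβ : 0 < β) (α : Fin 2) {K : Module.End ℂ D} (hK : IsEven Γ K)
    (hKsymm : K.IsSymmetric) (hKQ : ∀ γ ∈ s, Commute K (Q γ α))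
    (hKQbar : ∀ γ ∈ s, Commute K (Qbar γ α)) {T : ℝ → E →L[ℂ] E}
    (hT : ∀ γ ∈ s, IsGibbsOperator ((β : ℂ) • H γ - K) (T γ))
    (htr : ContinuousOn (fun γ => trace (T γ)) s) {γ γ' : ℝ} (hγ : γ ∈ s) (hγ' : γ' ∈ s) :
    trace (Γ ∘L T γ) = trace (Γ ∘L T γ') := by
  refine trace_parity_comp_eq hs hT (B := (β : ℂ) • bpsHamiltonian ρ P R α - K)
    ((isSymmetric_ofReal_smul ((halg γ hγ).isSymmetric_bpsHamiltonian α) β).sub hKsymm)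
    hΓ.restrict_isSymmetric hΓ.restrict_sq
    (fun γ hγ => (halg γ hγ).isSupercharge hΓ hβ α hK (hKQ γ hγ) (hKQbar γ hγ))
    (fun φ ψ => ?_) htr Γ hΓ.coe_restrict hγ hγ'
  simp only [LinearMap.sub_apply, LinearMap.smul_apply, Submodule.coe_sub, Submodule.coe_smul,
    inner_sub_right, inner_smul_right]
  exact ((hcont φ ψ).const_mul _).sub continuousOn_const

theorem IsEven.sum_smul {n : ℕ} {M : Fin n → Module.End ℂ D} (hM : ∀ j, IsEven Γ (M j))
    (μ : Fin n → ℂ) : IsEven Γ (∑ j, μ j • M j) := by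
  intro ψ φ h
  simp only [LinearMap.sum_apply, LinearMap.smul_apply, Submodule.coe_sum, Submodule.coe_smul,
    map_sum, map_smul, hM _ ψ φ h]

end Algebra

end

end WeakSUSY

open WeakSUSY in
theorem mainTheorem1 {E : Type*} [NormedAddCommGroup E] [InnerProductSpace ℂ E] [CompleteSpace E]
    (D : Submodule ℂ E) (Γ : E →L[ℂ] E) (hΓ : IsFermionParity D Γ)
    (ρ : ℝ) (hρ : 0 < ρ) (s : Set ℝ) (hs : s.OrdConnected)
    (P : Fin 3 → Module.End ℂ D) (R : Module.End ℂ D)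
    (Q Qbar : ℝ → Fin 2 → Module.End ℂ D) (H : ℝ → Module.End ℂ D)
    (halg : ∀ γ ∈ s, WeakSUSYAlgebra Γ ρ P R (Q γ) (Qbar γ) (H γ))
    (hcont : ∀ φ ψ : D, ContinuousOn (fun γ => ⟪(φ : E), (H γ ψ : E)⟫_ℂ) s) :
    (∀ β : ℝ, 0 < β →
      (∀ γ ∈ s, HasCompleteEigenstates {H γ}) →
      (∀ γ ∈ s, IsTraceClassRel (boltzmann β (H γ))) →
      ContinuousOn (fun γ => traceRel (boltzmann β (H γ))) s →
      (∀ γ ∈ s, HasDerivWithinAt (fun γ' => supertrace Γ (boltzmann β (H γ'))) 0 s γ) ∧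
      (∀ γ ∈ s, ∀ γ' ∈ s,
        supertrace Γ (boltzmann β (H γ)) = supertrace Γ (boltzmann β (H γ')))) ∧
    (∀ (n : ℕ) (M : Fin n → Module.End ℂ D) (μ : Fin n → ℝ) (α : Fin 2) (β : ℝ), 0 < β →
      (∀ j, IsEven Γ (M j)) →
      (∀ j, IsHermitianOn (M j)) →
      (∀ γ ∈ s, ∀ j, M j * H γ = H γ * M j) →
      (∀ γ ∈ s, ∀ j, M j * Q γ α = Q γ α * M j ∧ M j * Qbar γ α = Qbar γ α * M j) →
      (∀ γ ∈ s, HasCompleteEigenstates {H γ, ∑ j, (μ j : ℂ) • M j}) →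
      (∀ γ ∈ s, IsTraceClassRel (genBoltzmann β (H γ) μ M)) →
      ContinuousOn (fun γ => traceRel (genBoltzmann β (H γ) μ M)) s →
      (∀ γ ∈ s, HasDerivWithinAt (fun γ' => supertrace Γ (genBoltzmann β (H γ') μ M)) 0 s γ) ∧
      (∀ γ ∈ s, ∀ γ' ∈ s,
        supertrace Γ (genBoltzmann β (H γ) μ M) = supertrace Γ (genBoltzmann β (H γ') μ M))) := by
  have hderiv (f : ℝ → ℂ) (hf : ∀ γ ∈ s, ∀ γ' ∈ s, f γ = f γ') :
      ∀ γ ∈ s, HasDerivWithinAt f 0 s γ := fun γ hγ =>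
    (hasDerivWithinAt_const γ s (f γ)).congr (fun γ' hγ' => hf γ' hγ' γ hγ) rfl
  refine ⟨fun β hβ hd ht htr => ?_, fun n M μ α β hβ heven hherm _ hMQ hd ht htr => ?_⟩
  -- without `K`, either pair `Q_α`, `Q̄^α` serves as supercharge
  · have key : ∀ γ ∈ s, ∀ γ' ∈ s,
        supertrace Γ (boltzmann β (H γ)) = supertrace Γ (boltzmann β (H γ')) := by
      intro γ hγ γ' hγ'
      refine trace_parity_comp_eq_of_algebra hΓ hs halg hcont hβ 0 (K := 0)
        (T := fun γ => toBounded (boltzmann β (H γ))) (fun ψ φ _ => by simp)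
        LinearMap.IsSymmetric.zero (fun γ _ => Commute.zero_left _)
        (fun γ _ => Commute.zero_left _) (fun γ hγ => ?_) htr hγ hγ'
      rw [sub_zero]
      exact isGibbsOperator_boltzmann (halg γ hγ).herm_H β (hd γ hγ) (ht γ hγ)
    exact ⟨hderiv _ key, key⟩
  · have hK : (∑ j, (μ j : ℂ) • M j).IsSymmetric :=
      LinearMap.isSymmetric_sum _ fun j _ => isSymmetric_ofReal_smul (hherm j) (μ j)
    have key : ∀ γ ∈ s, ∀ γ' ∈ s,
        supertrace Γ (genBoltzmann β (H γ) μ M) = supertrace Γ (genBoltzmann β (H γ') μ M) := by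
      intro γ hγ γ' hγ'
      exact trace_parity_comp_eq_of_algebra hΓ hs halg hcont hβ α
        (T := fun γ => toBounded (genBoltzmann β (H γ) μ M))
        (IsEven.sum_smul heven fun j => (μ j : ℂ)) hK
        (fun γ hγ => Commute.sum_left _ _ _ fun j _ => Commute.smul_left (hMQ γ hγ j).1 _)
        (fun γ hγ => Commute.sum_left _ _ _ fun j _ => Commute.smul_left (hMQ γ hγ j).2 _)
        (fun γ hγ => isGibbsOperator_genBoltzmann (halg γ hγ).herm_H β μ M hK (hd γ hγ) (ht γ hγ))
        htr hγ hγ'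
    exact ⟨hderiv _ key, key⟩
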